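/- **Model.** The planar two-link robot with flexible joints has state $x=(q,p)\in\mathbb{R}^8$, $q=(q_l,q_m)$, $p=(p_l,p_m)$ with $q_l,q_m,p_l,p_m\in\mathbb{R}^2$, input $u\in\mathbb{R}^2$, and dynamics $$\begin{bmatrix}\dot q\\ \dot p\end{bmatrix}=\begin{bmatrix}0&I_4\\-I_4&-R_2\end{bmatrix}\begin{bmatrix}\nabla_qH(q,p)\\ \nabla_pH(q,p)\end{bmatrix}+\begin{bmatrix}0\\B\end{bmatrix}u,\qquad H(q,p)=\tfrac12p^\top M^{-1}(q_{l_2})p+\tfrac12\|q_l-q_m\|^2_{K_s},$$ where $\|v\|_A^2:=v^\top Av$, $B=\begin{bmatrix}0\\ I_2\end{bmatrix}$, $R_2=\mathrm{blockdiag}(D_l,D_m)$, $M(q_{l_2})=\mathrm{blockdiag}(M_l(q_{l_2}),M_m)$, $$M_l(q_{l_2})=\begin{bmatrix}a_1+a_2+2b\cos q_{l_2}&a_2+b\cos q_{l_2}\\a_2+b\cos q_{l_2}&a_2\end{bmatrix},$$ and $M_m=\mathrm{diag}(\mathcal I_{m_1},\mathcal I_{m_2})$, $D_l=\mathrm{diag}(D_{l_1},D_{l_2})$,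 $D_m=\mathrm{diag}(D_{m_1},D_{m_2})$, $K_s=\mathrm{diag}(k_{s_1},k_{s_2})$. All the constants $a_1,a_2,b,\mathcal I_{m_i},D_{l_i},D_{m_i},k_{s_i}$ are positive, and the inertia matrix $M_l(\theta)$ is positive definite for every $\theta\in\mathbb{R}$. **Proposition.** Let $q_*\in\mathbb{R}^2$ and let $K_{P_m},K_I,K_{P_l}\in\mathbb{R}^{2\times2}$ be such that $K_{P_m}$, $K_I$ and $$D_m+K_{P_m}-\tfrac14K_{P_l}D_l^{-1}K_{P_l}^\top$$ are (symmetric and) positive definite. Consider the robot in closed loop with $$u=-K_{P_m}\dot q_m-K_I(q_m-q_*)-K_{P_l}\dot q_l ,\qquad \dot q=\nabla_pH(q,p).$$ Then: (i) The closed loop is the port-Hamiltonian system $$\begin{bmatrix}\dot q\\ \dot p\end{bmatrix}=\begin{bmatrix}0&I_4\\-I_4&J_{PI_2}-R_{PI_2}\end{bmatrix}\begin{bmatrix}\nabla_qH_{PI}(q,p)\\ \nabla_pH_{PI}(q,p)\end{bmatrix},\qquad H_{PI}(q,p)=H(q,p)+\tfrac12\|q_m-q_*\|^2_{K_I},$$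 with the skew-symmetric matrix $J_{PI_2}=\tfrac12\begin{bmatrix}0&K_{P_l}^\top\\-K_{P_l}&0\end{bmatrix}$ and the symmetric positive definite matrix $R_{PI_2}=\begin{bmatrix}D_l&\frac12K_{P_l}^\top\\ \frac12K_{P_l}&D_m+K_{P_m}\end{bmatrix}$. (ii) The point $x_*=(q_l,q_m,p_l,p_m)=(q_*,q_*,0,0)$ is an asymptotically stable equilibrium of the closed loop (solutions starting near $x_*$ exist for all $t\ge0$, stay near $x_*$, and converge to $x_*$), and $H_{PI}$ is a Lyapunov function for it: $H_{PI}$ is continuously differentiable, $H_{PI}(x_*)=0$, $H_{PI}>0$ elsewhere, and $\dot H_{PI}\le0$ along the closed loop. -/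

import Mathlib

open scoped Matrix Gradient InnerProductSpace Topology
open Filter

noncomputable section

/-! ### Autonomous systems on Euclidean space -/

/-- `x` is a forward solution, on `[0, ∞)`, of the differential equation `x' = f x`. -/
def IsForwardSolution {ι : Type} [Fintype ι]
    (f : EuclideanSpace ℝ ι → EuclideanSpace ℝ ι) (x : ℝ → EuclideanSpace ℝ ι) : Prop :=
  ∀ t : ℝ, 0 ≤ t → HasDerivWithinAt x (f (x t)) (Set.Ici 0) t

/-- Lyapunov stability of the equilibrium `xs` of `x' = f x`: solutions that start close enough to
`xs` exist for all forward time and stay as close to `xs` as prescribed. -/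
structure IsStableEquilibrium {ι : Type} [Fintype ι]
    (f : EuclideanSpace ℝ ι → EuclideanSpace ℝ ι) (xs : EuclideanSpace ℝ ι) : Prop where
  equilibrium : f xs = 0
  stable : ∀ ε : ℝ, 0 < ε → ∃ δ : ℝ, 0 < δ ∧ ∀ x₀ : EuclideanSpace ℝ ι, ‖x₀ - xs‖ < δ →
    (∃ x : ℝ → EuclideanSpace ℝ ι, IsForwardSolution f x ∧ x 0 = x₀) ∧
    ∀ x : ℝ → EuclideanSpace ℝ ι, IsForwardSolution f x → x 0 = x₀ →
      ∀ t : ℝ, 0 ≤ t → ‖x t - xs‖ < ε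

/-- Asymptotic stability: stability, and all solutions that start close enough to `xs` converge
to `xs`. -/
structure IsAsymptoticallyStableEquilibrium {ι : Type} [Fintype ι]
    (f : EuclideanSpace ℝ ι → EuclideanSpace ℝ ι) (xs : EuclideanSpace ℝ ι) : Prop
    extends IsStableEquilibrium f xs where
  attractive : ∃ δ : ℝ, 0 < δ ∧ ∀ x : ℝ → EuclideanSpace ℝ ι, IsForwardSolution f x →
    ‖x 0 - xs‖ < δ → Tendsto x atTop (𝓝 xs)

/-- `V` is a Lyapunov function for the equilibrium `xs` of `x' = f x`: it is continuously
differentiable, vanishes at `xs`, is positive elsewhere, and its derivative along the vector field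
is nonpositive. -/
structure IsLyapunovFunction {ι : Type} [Fintype ι]
    (f : EuclideanSpace ℝ ι → EuclideanSpace ℝ ι) (xs : EuclideanSpace ℝ ι)
    (V : EuclideanSpace ℝ ι → ℝ) : Prop where
  contDiff : ContDiff ℝ 1 V
  zero : V xs = 0
  pos : ∀ x, x ≠ xs → 0 < V x
  nonincreasing : ∀ x, ⟪∇ V x, f x⟫_ℝ ≤ 0

/-- `x' = f x` is the port-Hamiltonian system `x' = (J - R) ∇H(x)` with Hamiltonian `H`,
interconnection matrix `J = -Jᵀ` and dissipation matrix `R = Rᵀ ≥ 0`. -/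
structure IsPortHamiltonian {ι : Type} [Fintype ι]
    (f : EuclideanSpace ℝ ι → EuclideanSpace ℝ ι) (H : EuclideanSpace ℝ ι → ℝ)
    (J R : Matrix ι ι ℝ) : Prop where
  contDiff : ContDiff ℝ 1 H
  skew : Jᵀ = -J
  posSemidef : R.PosSemidef
  dynamics : ∀ x, f x = WithLp.toLp 2 ((J - R) *ᵥ (∇ H x).ofLp)

/-- The weighted square `‖v‖²_A = vᵀ A v`. -/
def weightedSq {ι : Type} [Fintype ι] (A : Matrix ι ι ℝ) (v : ι → ℝ) : ℝ := v ⬝ᵥ A *ᵥ v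

/-! ### The planar robot with two flexible joints -/

/-- Indices of `q = (q_l, q_m)`, and also of `p = (p_l, p_m)`: links on the left, motors on the
right. -/
abbrev JointIdx : Type := Fin 2 ⊕ Fin 2

/-- The state `x = (q, p)`, with `q` on the left and `p` on the right. -/
abbrev RobotState : Type := EuclideanSpace ℝ (JointIdx ⊕ JointIdx)

/-- The state with components `q_l, q_m, p_l, p_m`. -/
def mkState (ql qm pl pm : Fin 2 → ℝ) : RobotState :=
  WithLp.toLp 2 (Sum.elim (Sum.elim ql qm) (Sum.elim pl pm))

/-- Link positions. -/
def linkPos (x : RobotState) : Fin 2 → ℝ := fun i => x (Sum.inl (Sum.inl i))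

/-- Motor positions. -/
def motorPos (x : RobotState) : Fin 2 → ℝ := fun i => x (Sum.inl (Sum.inr i))

/-- The full momentum vector `p = (p_l, p_m)`. -/
def momentum (x : RobotState) : JointIdx → ℝ := fun i => x (Sum.inr i)

/-- The physical constants of the robot. -/
structure RobotParams where
  /-- inertia constants of the links -/
  a₁ : ℝ
  a₂ : ℝ
  b : ℝ
  /-- moments of inertia of the motors -/
  motorMoI : Fin 2 → ℝ
  /-- damping on the links -/
  linkDamp : Fin 2 → ℝ
  /-- damping on the motors -/
  motorDamp : Fin 2 → ℝ
  /-- spring constants -/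
  spring : Fin 2 → ℝ

/-- All the physical constants are positive. -/
structure RobotParams.Positive (P : RobotParams) : Prop where
  a₁ : 0 < P.a₁
  a₂ : 0 < P.a₂
  b : 0 < P.b
  motorMoI : ∀ i, 0 < P.motorMoI i
  linkDamp : ∀ i, 0 < P.linkDamp i
  motorDamp : ∀ i, 0 < P.motorDamp i
  spring : ∀ i, 0 < P.spring i

namespace RobotParams

variable (P : RobotParams)

/-- The inertia matrix `M_l(θ)` of the links, `θ` being the angle of the second link. -/
def linkInertia (θ : ℝ) : Matrix (Fin 2) (Fin 2) ℝ :=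
  !![P.a₁ + P.a₂ + 2 * P.b * Real.cos θ, P.a₂ + P.b * Real.cos θ;
     P.a₂ + P.b * Real.cos θ, P.a₂]

/-- The inertia matrix `M(θ) = blockdiag(M_l(θ), M_m)`. -/
def inertia (θ : ℝ) : Matrix JointIdx JointIdx ℝ :=
  Matrix.fromBlocks (P.linkInertia θ) 0 0 (Matrix.diagonal P.motorMoI)

/-- The matrix `D_l`. -/
def Dl : Matrix (Fin 2) (Fin 2) ℝ := Matrix.diagonal P.linkDamp

/-- The matrix `D_m`. -/
def Dm : Matrix (Fin 2) (Fin 2) ℝ := Matrix.diagonal P.motorDamp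

/-- The matrix `K_s`. -/
def Ks : Matrix (Fin 2) (Fin 2) ℝ := Matrix.diagonal P.spring

/-- The damping matrix `R₂ = blockdiag(D_l, D_m)`. -/
def R₂ : Matrix JointIdx JointIdx ℝ := Matrix.fromBlocks P.Dl 0 0 P.Dm

/-- The Hamiltonian `H(q, p) = ½ pᵀ M(q_{l₂})⁻¹ p + ½ ‖q_l - q_m‖²_{K_s}`. -/
def hamiltonian (x : RobotState) : ℝ :=
  (1 / 2) * weightedSq (P.inertia (linkPos x 1))⁻¹ (momentum x)
    + (1 / 2) * weightedSq P.Ks (linkPos x - motorPos x)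

/-- The input matrix `B = [0; I₂]`. -/
def B : Matrix JointIdx (Fin 2) ℝ := Matrix.fromRows 0 1

/-- The open-loop dynamics
`(q', p') = [0, I₄; -I₄, -R₂] (∇_q H, ∇_p H) + [0; B] u` of the robot. -/
def plant (x : RobotState) (u : Fin 2 → ℝ) : RobotState :=
  WithLp.toLp 2
    (Matrix.fromBlocks 0 1 (-1) (-P.R₂) *ᵥ (∇ P.hamiltonian x).ofLp
      + Matrix.fromRows (0 : Matrix JointIdx (Fin 2) ℝ) B *ᵥ u)

/-- The link velocities `q_l' = ∇_{p_l} H`. -/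
def linkVel (x : RobotState) : Fin 2 → ℝ := fun i => ∇ P.hamiltonian x (Sum.inr (Sum.inl i))

/-- The motor velocities `q_m' = ∇_{p_m} H`. -/
def motorVel (x : RobotState) : Fin 2 → ℝ := fun i => ∇ P.hamiltonian x (Sum.inr (Sum.inr i))

/-- Whatever the input, the link positions move with velocity `linkVel`. -/
theorem linkPos_plant (x : RobotState) (u : Fin 2 → ℝ) : linkPos (P.plant x u) = P.linkVel x := by
  funext i
  simp [linkPos, plant, linkVel, Matrix.fromBlocks_mulVec, Matrix.fromRows_mulVec]

/-- Whatever the input, the motor positions move with velocity `motorVel`. -/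
theorem motorPos_plant (x : RobotState) (u : Fin 2 → ℝ) :
    motorPos (P.plant x u) = P.motorVel x := by
  funext i
  simp [motorPos, plant, motorVel, Matrix.fromBlocks_mulVec, Matrix.fromRows_mulVec]

/-- The control law `u = -K_{P_m} q_m' - K_I (q_m - q_*) - K_{P_l} q_l'`. -/
def piLaw (KPm KI KPl : Matrix (Fin 2) (Fin 2) ℝ) (qs : Fin 2 → ℝ) (x : RobotState) :
    Fin 2 → ℝ :=
  -(KPm *ᵥ P.motorVel x) - KI *ᵥ (motorPos x - qs) - KPl *ᵥ P.linkVel x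

/-- The vector field of the robot in closed loop with the control law `piLaw`. -/
def closedLoop (KPm KI KPl : Matrix (Fin 2) (Fin 2) ℝ) (qs : Fin 2 → ℝ) (x : RobotState) :
    RobotState :=
  P.plant x (P.piLaw KPm KI KPl qs x)

/-- The closed-loop Hamiltonian `H_PI = H + ½ ‖q_m - q_*‖²_{K_I}`. -/
def hamiltonianPI (KI : Matrix (Fin 2) (Fin 2) ℝ) (qs : Fin 2 → ℝ) (x : RobotState) : ℝ :=
  P.hamiltonian x + (1 / 2) * weightedSq KI (motorPos x - qs)

/-- The closed-loop damping matrix `R_PI₂`. -/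
def RPI₂ (KPm KPl : Matrix (Fin 2) (Fin 2) ℝ) : Matrix JointIdx JointIdx ℝ :=
  Matrix.fromBlocks P.Dl ((1 / 2 : ℝ) • KPlᵀ) ((1 / 2 : ℝ) • KPl) (P.Dm + KPm)

end RobotParams

/-- The closed-loop gyroscopic matrix `J_PI₂`. -/
def JPI₂ (KPl : Matrix (Fin 2) (Fin 2) ℝ) : Matrix JointIdx JointIdx ℝ :=
  (1 / 2 : ℝ) • Matrix.fromBlocks 0 KPlᵀ (-KPl) 0

end

/-! Substituting `u` adds the integral term to the potential and turns the damping block into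
`[-D_l, 0; -K_{P_l}, -(D_m + K_{P_m})]`, whose skew and symmetric parts are `JPI₂` and `-RPI₂`. The
gain condition is positivity of the Schur complement of `D_l` in `RPI₂`, so `RPI₂` is positive
definite. The skew part does no work, hence `H_PI' = -‖∇_p H_PI‖²` in the weight `RPI₂`, and `H_PI`
is a Lyapunov function.

The dissipation vanishes only where `∇_p H_PI = 0`, that is, where `p = 0`. Attractivity then
follows from Barbalat's lemma, used twice in place of LaSalle's limit sets. Along a bounded solution
`H_PI` converges, so `H_PI' → 0` and therefore `p → 0`; applied again to `p`, the lemma gives `p' →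
0`. Where `H_PI'` and `p'` both vanish, `∇_p H_PI = 0` and `∇_q H_PI = -p' = 0`. Such a critical
point is `x_*`, because for `p = 0` the function `H_PI` is a positive definite quadratic form in `q
- (q_*, q_*)`.

Forward existence near `x_*` comes from cutting the field off by a bump function: the Lyapunov
function still traps solutions, in a ball where the cut-off field equals the original one. -/

section LyapunovStability

open Set Metric
open scoped NNReal

/-! ### Solutions of autonomous systems -/

section Solutions

variable {ι : Type} [Fintype ι] {f : EuclideanSpace ℝ ι → EuclideanSpace ℝ ι}
  {x : ℝ → EuclideanSpace ℝ ι} {xs : EuclideanSpace ℝ ι} {V φ : EuclideanSpace ℝ ι → ℝ}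

theorem IsForwardSolution.continuousOn (hx : IsForwardSolution f x) : ContinuousOn x (Ici 0) :=
  fun t ht => (hx t ht).continuousWithinAt

theorem IsForwardSolution.hasDerivWithinAt_comp (hx : IsForwardSolution f x)
    (hφ : ContDiff ℝ 1 φ) {t : ℝ} (ht : 0 ≤ t) :
    HasDerivWithinAt (fun s => φ (x s)) (⟪∇ φ (x t), f (x t)⟫_ℝ) (Ici 0) t := by
  rw [inner_gradient_left]
  exact (hφ.differentiable one_ne_zero (x t)).hasFDerivAt.comp_hasDerivWithinAt t (hx t ht)

theorem continuous_gradient_of_contDiff (hφ : ContDiff ℝ 1 φ) : Continuous (∇ φ) :=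
  (InnerProductSpace.toDual ℝ _).symm.continuous.comp (hφ.continuous_fderiv one_ne_zero)

theorem IsForwardSolution.antitoneOn_comp (hx : IsForwardSolution f x) (hV : ContDiff ℝ 1 V)
    (hVf : ∀ y, ⟪∇ V y, f y⟫_ℝ ≤ 0) : AntitoneOn (fun t => V (x t)) (Ici 0) := by
  have hd : ∀ t ∈ interior (Ici (0 : ℝ)),
      HasDerivAt (fun s => V (x s)) (⟪∇ V (x t), f (x t)⟫_ℝ) t := fun t ht => by
    rw [interior_Ici] at ht
    exact (hx.hasDerivWithinAt_comp hV (le_of_lt ht)).hasDerivAt (Ici_mem_nhds ht)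
  refine antitoneOn_of_deriv_nonpos (convex_Ici 0)
    (hV.continuous.comp_continuousOn hx.continuousOn)
    (fun t ht => (hd t ht).differentiableAt.differentiableWithinAt) fun t ht => ?_
  rw [(hd t ht).deriv]
  exact hVf _

/-- A bounded Lipschitz vector field has global forward solutions. -/
theorem exists_isForwardSolution_of_lipschitzWith {K L : ℝ≥0} (hK : LipschitzWith K f)
    (hL : ∀ y, ‖f y‖ ≤ L) (x₀ : EuclideanSpace ℝ ι) :
    ∃ x, IsForwardSolution f x ∧ x 0 = x₀ := by
  have hloc : ∀ n : ℕ, ∃ α : ℝ → EuclideanSpace ℝ ι, α 0 = x₀ ∧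
      ∀ t ∈ Icc (0 : ℝ) n, HasDerivWithinAt α (f (α t)) (Icc (0 : ℝ) n) t := by
    intro n
    -- Since the speed is at most `L` everywhere, a ball of radius `L * n` suffices for the whole
    -- interval `[0, n]`.
    have hpl : IsPicardLindelof (fun _ => f) (⟨0, left_mem_Icc.2 n.cast_nonneg⟩ : Icc (0 : ℝ) n)
        x₀ (L * n) 0 L K :=
      IsPicardLindelof.of_time_independent (fun y _ => hL y) hK.lipschitzOnWith (by simp)
    exact hpl.exists_eq_forall_mem_Icc_hasDerivWithinAt₀
  choose α hα0 hα using hloc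
  have hright : ∀ n : ℕ, ∀ t ∈ Ico (0 : ℝ) n, HasDerivWithinAt (α n) (f (α n t)) (Ici t) t :=
    fun n t ht => (hα n t (Ico_subset_Icc_self ht)).mono_of_mem_nhdsWithin
      (mem_of_superset (Icc_mem_nhdsGE ht.2) (Icc_subset_Icc_left ht.1))
  have heq : ∀ {m n : ℕ}, m ≤ n → EqOn (α m) (α n) (Icc 0 m) := by
    intro m n hmn
    have hmn' : (m : ℝ) ≤ n := by exact_mod_cast hmn
    refine ODE_solution_unique_of_mem_Icc_right (v := fun _ => f) (s := fun _ => univ) (K := K)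
      (fun _ _ => hK.lipschitzOnWith) (fun t ht => (hα m t ht).continuousWithinAt)
      (hright m) (fun _ _ => mem_univ _)
      (fun t ht => ((hα n t ⟨ht.1, ht.2.trans hmn'⟩).continuousWithinAt).mono
        (Icc_subset_Icc_right hmn'))
      (fun t ht => hright n t ⟨ht.1, ht.2.trans_le hmn'⟩) (fun _ _ => mem_univ _) ?_
    rw [hα0, hα0]
  have hx : ∀ n : ℕ, ∀ t ∈ Ico (0 : ℝ) n, α (⌊t⌋₊ + 1) t = α n t := by
    intro n t ht
    refine heq ?_ ⟨ht.1, by exact_mod_cast (Nat.lt_floor_add_one t).le⟩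
    exact Nat.succ_le_of_lt ((Nat.floor_lt ht.1).2 ht.2)
  -- The index `⌊t⌋₊ + 1` exceeds `t` strictly, so near `t` the glued curve coincides with a single
  -- `α n`.
  refine ⟨fun t => α (⌊t⌋₊ + 1) t, fun t ht => ?_, hα0 _⟩
  set n : ℕ := ⌊t⌋₊ + 1 with hn
  have htn : t < n := by rw [hn]; exact_mod_cast Nat.lt_floor_add_one t
  have hd : HasDerivWithinAt (α n) (f (α n t)) (Ici 0) t := by
    refine (hα n t ⟨ht, htn.le⟩).mono_of_mem_nhdsWithin ?_
    filter_upwards [self_mem_nhdsWithin, mem_nhdsWithin_of_mem_nhds (Iio_mem_nhds htn)]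
      with s hs hs' using ⟨hs, le_of_lt hs'⟩
  refine hd.congr_of_eventuallyEq ?_ rfl
  filter_upwards [self_mem_nhdsWithin, mem_nhdsWithin_of_mem_nhds (Iio_mem_nhds htn)]
    with s hs hs' using hx n s ⟨hs, hs'⟩

end Solutions

/-! ### Lyapunov's stability theorem -/

section Stability

variable {ι : Type} [Fintype ι] {f : EuclideanSpace ℝ ι → EuclideanSpace ℝ ι}
  {xs : EuclideanSpace ℝ ι} {V : EuclideanSpace ℝ ι → ℝ}

/-- A positive definite function traps, near `xs`, the solutions of every system along which it does
not increase. -/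
theorem exists_ball_trapped (hV : ContDiff ℝ 1 V) (hV0 : V xs = 0)
    (hpos : ∀ y, y ≠ xs → 0 < V y) {ε : ℝ} (hε : 0 < ε) :
    ∃ δ, 0 < δ ∧ ∀ g : EuclideanSpace ℝ ι → EuclideanSpace ℝ ι,
      (∀ y, ⟪∇ V y, g y⟫_ℝ ≤ 0) → ∀ x, IsForwardSolution g x → ‖x 0 - xs‖ < δ →
        ∀ t, 0 ≤ t → ‖x t - xs‖ < ε := by
  obtain ⟨m, hm, hmV⟩ : ∃ m, 0 < m ∧ ∀ y ∈ sphere xs ε, m ≤ V y := by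
    -- The sphere is empty when the space has dimension zero.
    rcases (sphere xs ε).eq_empty_or_nonempty with he | hne
    · exact ⟨1, one_pos, by simp [he]⟩
    · obtain ⟨z, hz, hmin⟩ :=
        (isCompact_sphere xs ε).exists_isMinOn hne hV.continuous.continuousOn
      exact ⟨V z, hpos z (ne_of_mem_sphere hz hε.ne'), fun y hy => hmin hy⟩
  have hnhds : ∀ᶠ y in 𝓝 xs, V y < m :=
    hV.continuous.continuousAt.eventually_lt continuousAt_const (by simpa [hV0] using hm)
  obtain ⟨δ, hδ, hδV⟩ := Metric.eventually_nhds_iff.1 hnhds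
  -- The bound `δ` puts `V (x 0)` below the minimum `m` on the sphere; the bound `ε` makes the
  -- solution start inside the sphere, so that leaving means crossing it.
  refine ⟨min δ ε, lt_min hδ hε, fun g hg x hx h0 t ht => ?_⟩
  by_contra! hge
  have hcont : ContinuousOn (fun s => ‖x s - xs‖) (Icc 0 t) :=
    ((hx.continuousOn.mono Icc_subset_Ici_self).sub continuousOn_const).norm
  obtain ⟨s, hs, hsε⟩ := intermediate_value_Icc ht hcont
    ⟨(h0.trans_le (min_le_right _ _)).le, hge⟩
  have h1 : m ≤ V (x s) := hmV _ (by simpa [dist_eq_norm] using hsε)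
  have h2 : V (x s) ≤ V (x 0) := hx.antitoneOn_comp hV hg self_mem_Ici hs.1 hs.1
  have h3 : V (x 0) < m := hδV (by
    rw [dist_eq_norm]; exact h0.trans_le (min_le_left _ _))
  linarith

/-- **Lyapunov's stability theorem**, for continuously differentiable vector fields. -/
theorem IsLyapunovFunction.isStableEquilibrium (hV : IsLyapunovFunction f xs V)
    (hf : ContDiff ℝ 1 f) (hfs : f xs = 0) : IsStableEquilibrium f xs := by
  refine ⟨hfs, fun ε hε => ?_⟩
  obtain ⟨δ, hδ, htrap⟩ := exists_ball_trapped hV.contDiff hV.zero hV.pos hε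
  refine ⟨δ, hδ, fun x₀ hx₀ => ⟨?_, fun x hx h0 => htrap f hV.nonincreasing x hx (h0 ▸ hx₀)⟩⟩
  -- Multiplication by `χ ≥ 0` keeps `V` nonincreasing, so the same `δ` traps the solutions of `g`,
  -- in the ball where `χ = 1`.
  let χ : ContDiffBump xs := ⟨ε, ε + 1, hε, lt_add_one ε⟩
  let g : EuclideanSpace ℝ ι → EuclideanSpace ℝ ι := fun y => χ y • f y
  have hg : ContDiff ℝ 1 g := χ.contDiff.smul hf
  have hgs : HasCompactSupport g := χ.hasCompactSupport.smul_right
  obtain ⟨K, hK⟩ := hg.lipschitzWith_of_hasCompactSupport hgs one_ne_zero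
  obtain ⟨L, hL⟩ := hgs.exists_bound_of_continuous hg.continuous
  have hgV : ∀ y, ⟪∇ V y, g y⟫_ℝ ≤ 0 := fun y => by
    simp only [g, inner_smul_right]
    exact mul_nonpos_of_nonneg_of_nonpos χ.nonneg (hV.nonincreasing y)
  obtain ⟨x, hx, h0⟩ := exists_isForwardSolution_of_lipschitzWith (L := L.toNNReal) hK
    (fun y => (hL y).trans (Real.le_coe_toNNReal L)) x₀
  refine ⟨x, fun t ht => ?_, h0⟩
  have hball : x t ∈ closedBall xs ε := by
    rw [mem_closedBall, dist_eq_norm]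
    exact (htrap g hgV x hx (h0 ▸ hx₀) t ht).le
  have hgf : g (x t) = f (x t) := by
    simp only [g, χ.one_of_mem_closedBall hball, one_smul]
  exact hgf ▸ hx t ht

end Stability

/-! ### An invariance principle -/

section Attractivity

/-- **Barbalat's lemma**. -/
theorem tendsto_zero_of_uniformContinuousOn_deriv {φ ψ : ℝ → ℝ} {l : ℝ}
    (hφ : ∀ t, 0 ≤ t → HasDerivWithinAt φ (ψ t) (Ici 0) t) (hψ : UniformContinuousOn ψ (Ici 0))
    (hl : Tendsto φ atTop (𝓝 l)) : Tendsto ψ atTop (𝓝 0) := by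
  rw [Metric.tendsto_atTop]
  intro ε hε
  obtain ⟨δ, hδ, hδψ⟩ := Metric.uniformContinuousOn_iff.1 hψ (ε / 2) (half_pos hε)
  -- Over a step of length `δ / 2`, `φ` then changes by less than `ε * δ / 8`, so its slope there is
  -- below `ε / 4`.
  obtain ⟨T, hT⟩ := Metric.tendsto_atTop.1 hl (ε * δ / 16) (by positivity)
  refine ⟨max T 0, fun t ht => ?_⟩
  have htT : T ≤ t := (le_max_left _ _).trans ht
  have ht0 : 0 ≤ t := (le_max_right _ _).trans ht
  obtain ⟨c, hc, hslope⟩ := exists_hasDerivAt_eq_slope φ ψ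
    (show t < t + δ / 2 by linarith)
    (fun s hs => ((hφ s (ht0.trans hs.1)).continuousWithinAt).mono
      fun r hr => ht0.trans hr.1)
    (fun s hs => (hφ s (ht0.trans hs.1.le)).hasDerivAt (Ici_mem_nhds (ht0.trans_lt hs.1)))
  have h1 := hT t htT
  have h2 := hT (t + δ / 2) (by linarith)
  have h3 := hδψ c (ht0.trans hc.1.le) t ht0 (by
    rw [Real.dist_eq, abs_of_nonneg (by linarith [hc.1])]; linarith [hc.2])
  rw [Real.dist_eq, abs_lt] at h1 h2 h3
  have h4 : |ψ c| < ε / 2 := by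
    rw [hslope, abs_lt]
    constructor
    · rw [lt_div_iff₀ (by linarith)]; nlinarith
    · rw [div_lt_iff₀ (by linarith)]; nlinarith
  rw [abs_lt] at h4
  rw [Real.dist_eq, abs_lt]
  constructor <;> linarith [h4.1, h4.2, h3.1, h3.2]

/-- Along a filter whose image lies in a compact set, `h` tends to the value it takes on the common
zeros of a family of functions that tend to zero. -/
theorem tendsto_of_forall_eq_zero {α X Y κ : Type*} [TopologicalSpace X] [TopologicalSpace Y]
    {K : Set X} (hK : IsCompact K) {l : Filter α} {x : α → X} (hx : ∀ᶠ a in l, x a ∈ K)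
    {g : κ → X → ℝ} (hg : ∀ k, Continuous (g k))
    (hgx : ∀ k, Tendsto (fun a => g k (x a)) l (𝓝 0)) {h : X → Y} (hh : Continuous h) {c : Y}
    (hgh : ∀ y, (∀ k, g k y = 0) → h y = c) : Tendsto (fun a => h (x a)) l (𝓝 c) := by
  -- Ultrafilters play the part of subsequences: each has a limit point `y` in `K`, where every `g
  -- k` vanishes by uniqueness of limits.
  rw [tendsto_iff_ultrafilter]
  intro u hu
  obtain ⟨y, -, hy⟩ := hK.ultrafilter_le_nhds (u.map x) (le_principal_iff.2 (hu hx))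
  have hy' : Tendsto x u (𝓝 y) := hy
  rw [← hgh y fun k => tendsto_nhds_unique (((hg k).tendsto y).comp hy') ((hgx k).mono_left hu)]
  exact (hh.tendsto y).comp hy'

variable {ι : Type} [Fintype ι] {f : EuclideanSpace ℝ ι → EuclideanSpace ℝ ι}
  {x : ℝ → EuclideanSpace ℝ ι} {xs : EuclideanSpace ℝ ι} {V φ : EuclideanSpace ℝ ι → ℝ}

/-- Confinement to a compact ball bounds `f`, so the solution is Lipschitz and the derivative of `φ`
along it is uniformly continuous, as Barbalat's lemma requires. -/
theorem IsForwardSolution.tendsto_inner_gradient (hx : IsForwardSolution f x)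
    (hf : Continuous f) {R : ℝ} (hR : ∀ t, 0 ≤ t → x t ∈ closedBall xs R)
    (hφ : ContDiff ℝ 1 φ) {l : ℝ} (hl : Tendsto (fun t => φ (x t)) atTop (𝓝 l)) :
    Tendsto (fun t => ⟪∇ φ (x t), f (x t)⟫_ℝ) atTop (𝓝 0) := by
  refine tendsto_zero_of_uniformContinuousOn_deriv
    (fun t ht => hx.hasDerivWithinAt_comp hφ ht) ?_ hl
  obtain ⟨C, hC⟩ := (isCompact_closedBall xs R).exists_bound_of_continuousOn hf.continuousOn
  have hlip : LipschitzOnWith C.toNNReal x (Ici 0) :=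
    (convex_Ici 0).lipschitzOnWith_of_nnnorm_hasDerivWithin_le (fun t ht => hx t ht)
      fun t ht => by
        rw [← NNReal.coe_le_coe]
        exact (hC _ (hR t ht)).trans (Real.le_coe_toNNReal C)
  have huc : UniformContinuousOn (fun y => ⟪∇ φ y, f y⟫_ℝ) (closedBall xs R) :=
    (isCompact_closedBall xs R).uniformContinuousOn_of_continuous
      ((continuous_gradient_of_contDiff hφ).inner hf).continuousOn
  exact huc.comp hlip.uniformContinuousOn hR

/-- An invariance principle: `xs` is asymptotically stable if some functions `h k` vanish wherever the Lyapunov function is stationary, and their derivatives vanish there at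
`xs` only. -/
theorem IsLyapunovFunction.isAsymptoticallyStableEquilibrium {κ : Type*}
    (hV : IsLyapunovFunction f xs V) (hf : ContDiff ℝ 1 f) (hfs : f xs = 0)
    {h : κ → EuclideanSpace ℝ ι → ℝ} (hh : ∀ k, ContDiff ℝ 1 (h k))
    (hstat : ∀ y, ⟪∇ V y, f y⟫_ℝ = 0 → ∀ k, h k y = 0)
    (hinv : ∀ y, ⟪∇ V y, f y⟫_ℝ = 0 → (∀ k, ⟪∇ (h k) y, f y⟫_ℝ = 0) → y = xs) :
    IsAsymptoticallyStableEquilibrium f xs := by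
  refine ⟨hV.isStableEquilibrium hf hfs, ?_⟩
  obtain ⟨δ, hδ, htrap⟩ := exists_ball_trapped hV.contDiff hV.zero hV.pos one_pos
  refine ⟨δ, hδ, fun x hx h0 => ?_⟩
  have hball : ∀ t, 0 ≤ t → x t ∈ closedBall xs 1 := fun t ht => by
    rw [mem_closedBall, dist_eq_norm]
    exact (htrap f hV.nonincreasing x hx h0 t ht).le
  have hev : ∀ᶠ t in atTop, x t ∈ closedBall xs 1 := (eventually_ge_atTop 0).mono hball
  have hcont : ∀ {φ : EuclideanSpace ℝ ι → ℝ}, ContDiff ℝ 1 φ →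
      Continuous fun y => ⟪∇ φ y, f y⟫_ℝ :=
    fun hφ => (continuous_gradient_of_contDiff hφ).inner hf.continuous
  have hVnn : ∀ y, 0 ≤ V y := fun y => by
    rcases eq_or_ne y xs with rfl | hy
    exacts [hV.zero.ge, (hV.pos y hy).le]
  -- Replacing `t` by `max t 0` extends the monotonicity from `[0, ∞)` to all times.
  have hanti : Antitone fun t => V (x (max t 0)) := fun s t hst =>
    hx.antitoneOn_comp hV.contDiff hV.nonincreasing (mem_Ici.2 (le_max_right _ _))
      (mem_Ici.2 (le_max_right _ _)) (max_le_max_right 0 hst)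
  have hVlim : Tendsto (fun t => V (x t)) atTop (𝓝 (⨅ t, V (x (max t 0)))) := by
    refine (tendsto_atTop_ciInf hanti ⟨0, by rintro _ ⟨t, rfl⟩; exact hVnn _⟩).congr' ?_
    filter_upwards [eventually_ge_atTop 0] with t ht
    rw [max_eq_left ht]
  have hdV := hx.tendsto_inner_gradient hf.continuous hball hV.contDiff hVlim
  have hhlim : ∀ k, Tendsto (fun t => h k (x t)) atTop (𝓝 0) := fun k =>
    tendsto_of_forall_eq_zero (κ := Unit) (isCompact_closedBall xs 1) hev
      (fun _ => hcont hV.contDiff) (fun _ => hdV) (hh k).continuous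
      fun y hy => hstat y (hy ()) k
  -- The index `none` stands for the derivative of `V`, and `some k` for that of `h k`.
  exact tendsto_of_forall_eq_zero (κ := Option κ) (isCompact_closedBall xs 1) hev
    (g := fun o y => o.elim ⟪∇ V y, f y⟫_ℝ fun k => ⟪∇ (h k) y, f y⟫_ℝ)
    (fun o => by
      cases o with
      | none => exact hcont hV.contDiff
      | some k => exact hcont (hh k))
    (fun o => by
      cases o with
      | none => exact hdV
      | some k => exact hx.tendsto_inner_gradient hf.continuous hball (hh k) (hhlim k))
    continuous_id fun y hy => hinv y (hy none) fun k => hy (some k)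

end Attractivity

end LyapunovStability

/-! ### Matrices, Schur complements and quadratic forms -/

section MatrixLemmas

open Matrix

theorem ContDiff.matrix_det {E n : Type*} [NormedAddCommGroup E] [NormedSpace ℝ E] [Fintype n]
    [DecidableEq n] {k : WithTop ℕ∞} {M : E → Matrix n n ℝ}
    (hM : ∀ i j, ContDiff ℝ k fun x => M x i j) : ContDiff ℝ k fun x => (M x).det := by
  simp only [det_apply']
  exact ContDiff.sum fun σ _ => contDiff_const.mul (contDiff_prod fun i _ => hM _ _)

theorem ContDiff.matrix_inv_apply {E n : Type*} [NormedAddCommGroup E] [NormedSpace ℝ E]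
    [Fintype n] [DecidableEq n] {k : WithTop ℕ∞} {M : E → Matrix n n ℝ}
    (hM : ∀ i j, ContDiff ℝ k fun x => M x i j) (hdet : ∀ x, (M x).det ≠ 0) (i j : n) :
    ContDiff ℝ k fun x => (M x)⁻¹ i j := by
  -- Cramer's rule: each entry is a determinant with one row replaced, over `det`.
  simp only [inv_def, Ring.inverse_eq_inv', Matrix.smul_apply, smul_eq_mul, adjugate_apply]
  refine ((ContDiff.matrix_det hM).inv hdet).mul (ContDiff.matrix_det fun a c => ?_)
  simp only [updateRow_apply]
  split_ifs
  exacts [contDiff_const, hM a c]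

/-- The Schur complement criterion for positive definiteness. -/
theorem posDef_fromBlocks_of_schur {m n : Type*} [Fintype m] [Fintype n] [DecidableEq m]
    {A : Matrix m m ℝ} {B : Matrix m n ℝ} {D : Matrix n n ℝ} (hA : A.PosDef)
    (hD : (D - Bᴴ * A⁻¹ * B).PosDef) : (fromBlocks A B Bᴴ D).PosDef := by
  have := hA.isUnit.invertible
  refine PosDef.of_dotProduct_mulVec_pos
    ((IsHermitian.fromBlocks₁₁ B D hA.isHermitian).2 hD.isHermitian) fun x hx => ?_
  -- Completing the square, with `x = (u, w)`: the form is `‖u + A⁻¹Bw‖²_A` plus the Schur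
  -- complement form at `w`.
  rw [dotProduct_mulVec, ← Sum.elim_comp_inl_inr x, schur_complement_eq₁₁ B D _ _ hA.isHermitian,
    ← dotProduct_mulVec, ← dotProduct_mulVec (star (x ∘ Sum.inr))]
  by_cases hr : x ∘ Sum.inr = 0
  · have hl : x ∘ Sum.inl ≠ 0 := fun hl => hx (by
      rw [← Sum.elim_comp_inl_inr x, hl, hr]; funext i; cases i <;> rfl)
    simpa [hr] using hA.dotProduct_mulVec_pos hl
  · exact add_pos_of_nonneg_of_pos (hA.posSemidef.dotProduct_mulVec_nonneg _)
      (hD.dotProduct_mulVec_pos hr)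

theorem posSemidef_fromBlocks_zero {m n : Type*} [Fintype m] [Fintype n] {D : Matrix n n ℝ}
    (hD : D.PosSemidef) : (fromBlocks (0 : Matrix m m ℝ) 0 0 D).PosSemidef := by
  refine PosSemidef.of_dotProduct_mulVec_nonneg ?_ fun x => ?_
  · exact isHermitian_fromBlocks_iff.2 ⟨isHermitian_zero, by simp, by simp, hD.isHermitian⟩
  · simpa [fromBlocks_mulVec, dotProduct, Fintype.sum_sum_type] using
      hD.dotProduct_mulVec_nonneg (x ∘ Sum.inr)

theorem fromBlocks_sub_fromBlocks {l m n o R : Type*} [AddGroup R] (A A' : Matrix n l R)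
    (B B' : Matrix n m R) (C C' : Matrix o l R) (D D' : Matrix o m R) :
    fromBlocks A B C D - fromBlocks A' B' C' D'
      = fromBlocks (A - A') (B - B') (C - C') (D - D') := by
  ext (i | i) (j | j) <;> rfl

theorem dotProduct_mulVec_self_of_skew {n : Type*} [Fintype n] {J : Matrix n n ℝ} (hJ : Jᵀ = -J)
    (v : n → ℝ) : v ⬝ᵥ J *ᵥ v = 0 := by
  have h : v ⬝ᵥ J *ᵥ v = -(v ⬝ᵥ J *ᵥ v) := by
    conv_lhs => rw [dotProduct_mulVec, ← mulVec_transpose, hJ, neg_mulVec, neg_dotProduct,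
      dotProduct_comm]
  linarith

variable {ι : Type} [Fintype ι] {A : Matrix ι ι ℝ}

theorem weightedSq_smul (c : ℝ) (v : ι → ℝ) : weightedSq A (c • v) = c ^ 2 * weightedSq A v := by
  simp only [weightedSq, mulVec_smul, smul_dotProduct, dotProduct_smul, smul_eq_mul]
  ring

theorem weightedSq_add_smul (hA : A.IsHermitian) (u w : ι → ℝ) (s : ℝ) :
    weightedSq A (u + s • w)
      = weightedSq A u + s * (2 * (w ⬝ᵥ A *ᵥ u)) + s ^ 2 * weightedSq A w := by
  have h : u ⬝ᵥ A *ᵥ w = w ⬝ᵥ A *ᵥ u := by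
    have hA' : Aᵀ = A := by simpa using hA.eq
    rw [dotProduct_mulVec, ← mulVec_transpose, hA', dotProduct_comm]
  simp only [weightedSq, mulVec_add, mulVec_smul, add_dotProduct, dotProduct_add, smul_dotProduct,
    dotProduct_smul, smul_eq_mul, h]
  ring

theorem weightedSq_nonneg (hA : A.PosDef) (v : ι → ℝ) : 0 ≤ weightedSq A v :=
  hA.posSemidef.dotProduct_mulVec_nonneg v

theorem eq_zero_of_weightedSq_eq_zero (hA : A.PosDef) {v : ι → ℝ} (h : weightedSq A v = 0) :
    v = 0 := by
  by_contra hv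
  exact (hA.dotProduct_mulVec_pos hv).ne' h

theorem ContDiff.weightedSq {E : Type*} [NormedAddCommGroup E] [NormedSpace ℝ E]
    {k : WithTop ℕ∞} {M : E → Matrix ι ι ℝ} {v : E → ι → ℝ}
    (hM : ∀ i j, ContDiff ℝ k fun x => M x i j) (hv : ∀ i, ContDiff ℝ k fun x => v x i) :
    ContDiff ℝ k fun x => weightedSq (M x) (v x) := by
  simp only [_root_.weightedSq, dotProduct, mulVec]
  exact ContDiff.sum fun i _ => (hv i).mul (ContDiff.sum fun j _ => (hM i j).mul (hv j))

end MatrixLemmas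

/-! ### Gradients -/

section GradientLemmas

variable {E : Type*} [NormedAddCommGroup E] [InnerProductSpace ℝ E] [CompleteSpace E] {φ : E → ℝ}

/-- If `φ` is quadratic on a line, then its gradient along this line is the linear coefficient. -/
theorem inner_gradient_of_quadratic {x v : E} (hφ : DifferentiableAt ℝ φ x) {a b c : ℝ}
    (h : ∀ s : ℝ, φ (x + s • v) = c + s * b + s ^ 2 * a) : ⟪∇ φ x, v⟫_ℝ = b := by
  rw [inner_gradient_left]
  have hline : HasDerivAt (fun s : ℝ => x + s • v) v 0 := by
    simpa using ((hasDerivAt_id (0 : ℝ)).smul_const v).const_add x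
  have h1 : HasDerivAt (fun s : ℝ => φ (x + s • v)) (fderiv ℝ φ x v) 0 := by
    have hφ' : HasFDerivAt φ (fderiv ℝ φ x) (x + (0 : ℝ) • v) := by simpa using hφ.hasFDerivAt
    exact hφ'.comp_hasDerivAt 0 hline
  have h2 : HasDerivAt (fun s : ℝ => φ (x + s • v)) b 0 := by
    simp only [h]
    refine ((((hasDerivAt_id (0 : ℝ)).mul_const b).const_add c).fun_add
      (((hasDerivAt_id (0 : ℝ)).fun_pow 2).mul_const a)).congr_deriv ?_
    simp
  exact h1.unique h2

theorem ContDiff.gradient {m n : WithTop ℕ∞} (hφ : ContDiff ℝ n φ) (hmn : m + 1 ≤ n) :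
    ContDiff ℝ m (∇ φ) :=
  (InnerProductSpace.toDual ℝ E).symm.contDiff.comp (hφ.fderiv_right hmn)

end GradientLemmas

/-! ### Coordinates of the state -/

section StateCoordinates

theorem linkPos_add_smul (x v : RobotState) (s : ℝ) :
    linkPos (x + s • v) = linkPos x + s • linkPos v := rfl

theorem motorPos_add_smul (x v : RobotState) (s : ℝ) :
    motorPos (x + s • v) = motorPos x + s • motorPos v := rfl

theorem momentum_add_smul (x v : RobotState) (s : ℝ) :
    momentum (x + s • v) = momentum x + s • momentum v := rfl

theorem contDiff_state_apply {k : WithTop ℕ∞} (i : JointIdx ⊕ JointIdx) :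
    ContDiff ℝ k fun x : RobotState => x i :=
  (EuclideanSpace.proj (𝕜 := ℝ) i).contDiff

theorem inner_gradient_state_apply (i : JointIdx ⊕ JointIdx) (x v : RobotState) :
    ⟪∇ (fun y : RobotState => y i) x, v⟫_ℝ = v i := by
  rw [inner_gradient_left]
  exact congrArg (fun L => L v) (EuclideanSpace.proj (𝕜 := ℝ) i).hasFDerivAt.fderiv

theorem momentum_mkState (ql qm : Fin 2 → ℝ) : momentum (mkState ql qm 0 0) = 0 := by
  funext i
  cases i <;> rfl

theorem eq_mkState {x : RobotState} {ql qm : Fin 2 → ℝ} (hl : linkPos x = ql)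
    (hm : motorPos x = qm) (hp : momentum x = 0) : x = mkState ql qm 0 0 := by
  ext i
  rcases i with (i | i) | (i | i)
  exacts [congrFun hl i, congrFun hm i, congrFun hp (Sum.inl i), congrFun hp (Sum.inr i)]

end StateCoordinates

namespace RobotParams

open Matrix

variable {P : RobotParams} {KPm KI KPl : Matrix (Fin 2) (Fin 2) ℝ} {qs : Fin 2 → ℝ}

/-! ### The closed-loop Hamiltonian and its critical point -/

section Hamiltonian

theorem Positive.posDef_Dl (hP : P.Positive) : P.Dl.PosDef := PosDef.diagonal hP.linkDamp

theorem Positive.posDef_Ks (hP : P.Positive) : P.Ks.PosDef := PosDef.diagonal hP.spring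

theorem Positive.posDef_inertia (hP : P.Positive) (hM : ∀ θ : ℝ, (P.linkInertia θ).PosDef)
    (θ : ℝ) : (P.inertia θ).PosDef := by
  have h := posDef_fromBlocks_of_schur (B := 0) (hM θ) (D := diagonal P.motorMoI)
    (by simpa using hP.motorMoI)
  simpa [inertia] using h

theorem Positive.contDiff_hamiltonian (hP : P.Positive)
    (hM : ∀ θ : ℝ, (P.linkInertia θ).PosDef) {k : WithTop ℕ∞} : ContDiff ℝ k P.hamiltonian := by
  have hcos : ContDiff ℝ k fun x : RobotState => Real.cos (linkPos x 1) :=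
    Real.contDiff_cos.comp (contDiff_state_apply _)
  have hinertia : ∀ i j, ContDiff ℝ k fun x : RobotState => P.inertia (linkPos x 1) i j := by
    rintro (i | i) (j | j)
    · fin_cases i <;> fin_cases j <;> simp [inertia, linkInertia] <;> fun_prop
    all_goals exact contDiff_const
  refine (contDiff_const.mul (ContDiff.weightedSq (ContDiff.matrix_inv_apply hinertia
    fun x => ?_) fun i => contDiff_state_apply _)).add (contDiff_const.mul
      (ContDiff.weightedSq (fun _ _ => contDiff_const) fun i =>
        (contDiff_state_apply _).sub (contDiff_state_apply _)))
  exact ((isUnit_iff_isUnit_det _).1 (hP.posDef_inertia hM _).isUnit).ne_zero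

theorem contDiff_motorPotential {k : WithTop ℕ∞} :
    ContDiff ℝ k fun x : RobotState => (1 / 2) * weightedSq KI (motorPos x - qs) :=
  contDiff_const.mul (ContDiff.weightedSq (fun _ _ => contDiff_const) fun _ =>
    (contDiff_state_apply _).sub contDiff_const)

theorem Positive.contDiff_hamiltonianPI (hP : P.Positive)
    (hM : ∀ θ : ℝ, (P.linkInertia θ).PosDef) {k : WithTop ℕ∞} :
    ContDiff ℝ k (P.hamiltonianPI KI qs) :=
  (hP.contDiff_hamiltonian hM).add contDiff_motorPotential

theorem gradient_motorPotential (hKI : KI.IsHermitian) (x : RobotState) :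
    ∇ (fun y : RobotState => (1 / 2) * weightedSq KI (motorPos y - qs)) x
      = mkState 0 (KI *ᵥ (motorPos x - qs)) 0 0 := by
  refine ext_inner_right ℝ fun v => ?_
  rw [inner_gradient_of_quadratic (b := motorPos v ⬝ᵥ KI *ᵥ (motorPos x - qs))
    (c := (1 / 2) * weightedSq KI (motorPos x - qs)) (a := (1 / 2) * weightedSq KI (motorPos v))
    (contDiff_motorPotential (k := 1).differentiable one_ne_zero x)]
  · simp [mkState, PiLp.inner_apply, Fintype.sum_sum_type, dotProduct, motorPos]
  · intro s
    rw [motorPos_add_smul, add_sub_right_comm, weightedSq_add_smul hKI]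
    ring

theorem Positive.gradient_hamiltonianPI (hP : P.Positive)
    (hM : ∀ θ : ℝ, (P.linkInertia θ).PosDef) (hKI : KI.IsHermitian) (x : RobotState) :
    ∇ (P.hamiltonianPI KI qs) x
      = ∇ P.hamiltonian x + mkState 0 (KI *ᵥ (motorPos x - qs)) 0 0 := by
  rw [← gradient_motorPotential hKI]
  have h := fderiv_fun_add ((hP.contDiff_hamiltonian hM (k := 1)).differentiable one_ne_zero x)
    (contDiff_motorPotential (KI := KI) (qs := qs) (k := 1).differentiable one_ne_zero x)
  simp only [_root_.gradient, ← map_add, ← h]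
  rfl

theorem hamiltonianPI_mkState : P.hamiltonianPI KI qs (mkState qs qs 0 0) = 0 := by
  have hl : linkPos (mkState qs qs 0 0) = qs := rfl
  have hm : motorPos (mkState qs qs 0 0) = qs := rfl
  simp [hamiltonianPI, hamiltonian, hl, hm, momentum_mkState, weightedSq]

theorem Positive.hamiltonianPI_nonneg (hP : P.Positive)
    (hM : ∀ θ : ℝ, (P.linkInertia θ).PosDef) (hKI : KI.PosDef) (x : RobotState) :
    0 ≤ P.hamiltonianPI KI qs x := by
  have h1 := weightedSq_nonneg (hP.posDef_inertia hM (linkPos x 1)).inv (momentum x)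
  have h2 := weightedSq_nonneg hP.posDef_Ks (linkPos x - motorPos x)
  have h3 := weightedSq_nonneg hKI (motorPos x - qs)
  rw [hamiltonianPI, hamiltonian]
  linarith

theorem Positive.eq_of_hamiltonianPI_eq_zero (hP : P.Positive)
    (hM : ∀ θ : ℝ, (P.linkInertia θ).PosDef) (hKI : KI.PosDef) {x : RobotState}
    (hx : P.hamiltonianPI KI qs x = 0) : x = mkState qs qs 0 0 := by
  have h1 := weightedSq_nonneg (hP.posDef_inertia hM (linkPos x 1)).inv (momentum x)
  have h2 := weightedSq_nonneg hP.posDef_Ks (linkPos x - motorPos x)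
  have h3 := weightedSq_nonneg hKI (motorPos x - qs)
  rw [hamiltonianPI, hamiltonian] at hx
  have hp := eq_zero_of_weightedSq_eq_zero (hP.posDef_inertia hM (linkPos x 1)).inv
    (v := momentum x) (by linarith)
  have hlm := eq_zero_of_weightedSq_eq_zero hP.posDef_Ks (v := linkPos x - motorPos x)
    (by linarith)
  have hm := sub_eq_zero.1 (eq_zero_of_weightedSq_eq_zero hKI (v := motorPos x - qs)
    (by linarith))
  exact eq_mkState ((sub_eq_zero.1 hlm).trans hm) hm hp

/-- The Hamiltonian is quadratic in the momentum, which therefore vanishes with `∇_p H_PI`. -/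
theorem Positive.momentum_eq_zero_of_gradient (hP : P.Positive)
    (hM : ∀ θ : ℝ, (P.linkInertia θ).PosDef) {x : RobotState}
    (hx : ∀ i, ∇ (P.hamiltonianPI KI qs) x (Sum.inr i) = 0) : momentum x = 0 := by
  let v : RobotState := WithLp.toLp 2 (Sum.elim 0 (momentum x))
  have hl : linkPos v = 0 := rfl
  have hm : motorPos v = 0 := rfl
  have hp : momentum v = momentum x := rfl
  let T := weightedSq (P.inertia (linkPos x 1))⁻¹ (momentum x)
  have h : ⟪∇ (P.hamiltonianPI KI qs) x, v⟫_ℝ = T := by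
    refine inner_gradient_of_quadratic (a := T / 2) (c := P.hamiltonianPI KI qs x)
      ((hP.contDiff_hamiltonianPI hM (k := 1)).differentiable one_ne_zero x) fun s => ?_
    -- The kinetic energy scales by `(1 + s) ^ 2`, so its linear coefficient is `T`.
    have hs : momentum x + s • momentum x = (1 + s) • momentum x := by rw [add_smul, one_smul]
    simp only [hamiltonianPI, hamiltonian, linkPos_add_smul, motorPos_add_smul,
      momentum_add_smul, hl, hm, hp, smul_zero, add_zero, hs, weightedSq_smul, T]
    ring
  have h0 : ⟪∇ (P.hamiltonianPI KI qs) x, v⟫_ℝ = 0 := by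
    rw [PiLp.inner_apply, Fintype.sum_sum_type]
    simp [v, hx]
  exact eq_zero_of_weightedSq_eq_zero (hP.posDef_inertia hM (linkPos x 1)).inv (h.symm.trans h0)

/-- The only critical point of `H_PI` is the desired equilibrium. -/
theorem Positive.eq_of_gradient_hamiltonianPI_eq_zero (hP : P.Positive)
    (hM : ∀ θ : ℝ, (P.linkInertia θ).PosDef) (hKI : KI.PosDef) {x : RobotState}
    (hx : ∇ (P.hamiltonianPI KI qs) x = 0) : x = mkState qs qs 0 0 := by
  have hp : momentum x = 0 := hP.momentum_eq_zero_of_gradient (KI := KI) (qs := qs) hM fun i => by simp [hx]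
  refine hP.eq_of_hamiltonianPI_eq_zero hM hKI ?_
  -- Euler's identity along the ray from `x_*`: as `p = 0`, the dependence of the inertia on `q` is
  -- harmless and `H_PI` scales by `(1 + s) ^ 2`.
  let v : RobotState := x - mkState qs qs 0 0
  have hl : linkPos v = linkPos x - qs := rfl
  have hm : motorPos v = motorPos x - qs := rfl
  have hpv : momentum v = 0 :=
    calc momentum v = momentum x - momentum (mkState qs qs 0 0) := rfl
      _ = 0 := by rw [hp, momentum_mkState, sub_zero]
  have h : ⟪∇ (P.hamiltonianPI KI qs) x, v⟫_ℝ = 2 * P.hamiltonianPI KI qs x := by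
    refine inner_gradient_of_quadratic (a := P.hamiltonianPI KI qs x)
      (c := P.hamiltonianPI KI qs x)
      ((hP.contDiff_hamiltonianPI hM (k := 1)).differentiable one_ne_zero x) fun s => ?_
    have hs1 : motorPos x + s • (motorPos x - qs) - qs = (1 + s) • (motorPos x - qs) := by
      module
    have hs2 : linkPos x + s • (linkPos x - qs) - (motorPos x + s • (motorPos x - qs))
        = (1 + s) • (linkPos x - motorPos x) := by module
    have hz : ∀ A : Matrix JointIdx JointIdx ℝ, weightedSq A 0 = 0 := fun A => by
      simp [weightedSq]
    simp only [hamiltonianPI, hamiltonian, linkPos_add_smul, motorPos_add_smul,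
      momentum_add_smul, hl, hm, hpv, hp, smul_zero, add_zero, hs1, hs2, weightedSq_smul, hz]
    ring
  rw [hx, inner_zero_left] at h
  linarith

theorem Positive.gradient_hamiltonianPI_mkState (hP : P.Positive)
    (hM : ∀ θ : ℝ, (P.linkInertia θ).PosDef) (hKI : KI.PosDef) :
    ∇ (P.hamiltonianPI KI qs) (mkState qs qs 0 0) = 0 := by
  have hmin : IsLocalMin (P.hamiltonianPI KI qs) (mkState qs qs 0 0) :=
    Eventually.of_forall fun y => by
      rw [hamiltonianPI_mkState]; exact hP.hamiltonianPI_nonneg hM hKI y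
  rw [_root_.gradient, hmin.fderiv_eq_zero, map_zero]

end Hamiltonian

/-! ### Closed loop: port-Hamiltonian form, dissipation, stability -/

section ClosedLoop

theorem Positive.posDef_RPI₂ (hP : P.Positive)
    (hgain : (P.Dm + KPm - (1 / 4 : ℝ) • (KPl * P.Dl⁻¹ * KPlᵀ)).PosDef) :
    (P.RPI₂ KPm KPl).PosDef := by
  have h := posDef_fromBlocks_of_schur (B := (1 / 2 : ℝ) • KPlᵀ) (D := P.Dm + KPm) hP.posDef_Dl
    (by
      convert hgain using 2
      simp only [conjTranspose_eq_transpose_of_trivial, transpose_smul, transpose_transpose,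
        Matrix.smul_mul, Matrix.mul_smul]
      module)
  simpa [RPI₂, conjTranspose_smul] using h

theorem transpose_JPI₂ (KPl : Matrix (Fin 2) (Fin 2) ℝ) : (JPI₂ KPl)ᵀ = -JPI₂ KPl := by
  simp [JPI₂, fromBlocks_transpose, fromBlocks_neg, ← smul_neg]

/-- The halves of `K_{P_l}ᵀ` cancel in the upper right block and those of `K_{P_l}` add up in the
lower left: the feedback acts on the motors only. -/
theorem JPI₂_sub_RPI₂ (P : RobotParams) (KPm KPl : Matrix (Fin 2) (Fin 2) ℝ) :
    JPI₂ KPl - P.RPI₂ KPm KPl = fromBlocks (-P.Dl) 0 (-KPl) (-(P.Dm + KPm)) := by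
  rw [JPI₂, RPI₂, fromBlocks_smul, fromBlocks_sub_fromBlocks]
  congr 1
  · simp
  · simp
  · module
  · simp

theorem Positive.closedLoop_eq (hP : P.Positive) (hM : ∀ θ : ℝ, (P.linkInertia θ).PosDef)
    (hKI : KI.PosDef) (x : RobotState) :
    P.closedLoop KPm KI KPl qs x = WithLp.toLp 2
      ((fromBlocks 0 1 (-1) (JPI₂ KPl) - fromBlocks 0 0 0 (P.RPI₂ KPm KPl)) *ᵥ
        (∇ (P.hamiltonianPI KI qs) x).ofLp) := by
  rw [fromBlocks_sub_fromBlocks, JPI₂_sub_RPI₂, hP.gradient_hamiltonianPI hM hKI.isHermitian]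
  have hvl : (fun i => ∇ P.hamiltonian x (Sum.inr (Sum.inl i))) = P.linkVel x := rfl
  have hvm : (fun i => ∇ P.hamiltonian x (Sum.inr (Sum.inr i))) = P.motorVel x := rfl
  ext i
  rcases i with (i | i) | (i | i) <;>
    simp [closedLoop, plant, piLaw, B, R₂, fromBlocks_mulVec, fromRows_mulVec, mkState,
      Function.comp_def, hvl, hvm, neg_mulVec, add_mulVec] <;>
    fin_cases i <;> simp <;> ring

/-- The momentum equation of the closed loop, in terms of the gradient of `H_PI`. -/
theorem Positive.closedLoop_apply_inr (hP : P.Positive)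
    (hM : ∀ θ : ℝ, (P.linkInertia θ).PosDef) (hKI : KI.PosDef) (x : RobotState) (i : JointIdx) :
    P.closedLoop KPm KI KPl qs x (Sum.inr i) = -∇ (P.hamiltonianPI KI qs) x (Sum.inl i)
      + ((JPI₂ KPl - P.RPI₂ KPm KPl) *ᵥ
        fun j => ∇ (P.hamiltonianPI KI qs) x (Sum.inr j)) i := by
  simp [hP.closedLoop_eq hM hKI, fromBlocks_sub_fromBlocks, fromBlocks_mulVec, Function.comp_def, neg_mulVec]

/-- The power balance of the closed loop. -/
theorem Positive.inner_gradient_closedLoop (hP : P.Positive)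
    (hM : ∀ θ : ℝ, (P.linkInertia θ).PosDef) (hKI : KI.PosDef) (x : RobotState) :
    ⟪∇ (P.hamiltonianPI KI qs) x, P.closedLoop KPm KI KPl qs x⟫_ℝ
      = -weightedSq (P.RPI₂ KPm KPl) fun i => ∇ (P.hamiltonianPI KI qs) x (Sum.inr i) := by
  set g := ∇ (P.hamiltonianPI KI qs) x with hg
  have hl : ∀ i, P.closedLoop KPm KI KPl qs x (Sum.inl i) = g (Sum.inr i) := fun i => by
    simp [hP.closedLoop_eq hM hKI, fromBlocks_sub_fromBlocks, fromBlocks_mulVec, Function.comp_def, hg]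
  have hskew := dotProduct_mulVec_self_of_skew (transpose_JPI₂ KPl) fun i => g (Sum.inr i)
  have hsum : ⟪g, P.closedLoop KPm KI KPl qs x⟫_ℝ
      = (fun i => g (Sum.inr i)) ⬝ᵥ (JPI₂ KPl - P.RPI₂ KPm KPl) *ᵥ fun i => g (Sum.inr i) := by
    rw [PiLp.inner_apply, Fintype.sum_sum_type, ← Finset.sum_add_distrib]
    refine Finset.sum_congr rfl fun i _ => ?_
    rw [hl, hP.closedLoop_apply_inr hM hKI, ← hg]
    simp only [RCLike.inner_apply, conj_trivial]
    ring
  rw [hsum, sub_mulVec, dotProduct_sub, hskew, zero_sub, weightedSq]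

theorem Positive.isPortHamiltonian_closedLoop (hP : P.Positive)
    (hM : ∀ θ : ℝ, (P.linkInertia θ).PosDef) (hKI : KI.PosDef)
    (hR : (P.RPI₂ KPm KPl).PosDef) :
    IsPortHamiltonian (P.closedLoop KPm KI KPl qs) (P.hamiltonianPI KI qs)
      (fromBlocks 0 1 (-1) (JPI₂ KPl)) (fromBlocks 0 0 0 (P.RPI₂ KPm KPl)) where
  contDiff := hP.contDiff_hamiltonianPI hM
  skew := by simp [fromBlocks_transpose, fromBlocks_neg, transpose_JPI₂]
  posSemidef := posSemidef_fromBlocks_zero hR.posSemidef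
  dynamics := hP.closedLoop_eq hM hKI

theorem Positive.isLyapunovFunction_hamiltonianPI (hP : P.Positive)
    (hM : ∀ θ : ℝ, (P.linkInertia θ).PosDef) (hKI : KI.PosDef)
    (hR : (P.RPI₂ KPm KPl).PosDef) :
    IsLyapunovFunction (P.closedLoop KPm KI KPl qs) (mkState qs qs 0 0)
      (P.hamiltonianPI KI qs) where
  contDiff := hP.contDiff_hamiltonianPI hM
  zero := hamiltonianPI_mkState
  pos x hx := (hP.hamiltonianPI_nonneg hM hKI x).lt_of_ne fun h =>
    hx (hP.eq_of_hamiltonianPI_eq_zero hM hKI h.symm)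
  nonincreasing x := by
    rw [hP.inner_gradient_closedLoop hM hKI]
    exact neg_nonpos.2 (weightedSq_nonneg hR _)

theorem Positive.contDiff_closedLoop (hP : P.Positive)
    (hM : ∀ θ : ℝ, (P.linkInertia θ).PosDef) (hKI : KI.PosDef) :
    ContDiff ℝ 1 (P.closedLoop KPm KI KPl qs) := by
  have hg : ContDiff ℝ 1 (∇ (P.hamiltonianPI KI qs)) :=
    -- Taking the gradient costs one derivative.
    (hP.contDiff_hamiltonianPI hM (k := 2)).gradient (by norm_num)
  rw [funext (hP.closedLoop_eq hM hKI)]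
  exact (toEuclideanCLM (𝕜 := ℝ) (fromBlocks 0 1 (-1) (JPI₂ KPl)
    - fromBlocks 0 0 0 (P.RPI₂ KPm KPl))).contDiff.comp hg

theorem Positive.isAsymptoticallyStableEquilibrium_closedLoop (hP : P.Positive)
    (hM : ∀ θ : ℝ, (P.linkInertia θ).PosDef) (hKI : KI.PosDef)
    (hR : (P.RPI₂ KPm KPl).PosDef) :
    IsAsymptoticallyStableEquilibrium (P.closedLoop KPm KI KPl qs) (mkState qs qs 0 0) := by
  have hgp : ∀ y, ⟪∇ (P.hamiltonianPI KI qs) y, P.closedLoop KPm KI KPl qs y⟫_ℝ = 0 →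
      (fun i => ∇ (P.hamiltonianPI KI qs) y (Sum.inr i)) = 0 := fun y hy => by
    rw [hP.inner_gradient_closedLoop hM hKI, neg_eq_zero] at hy
    exact eq_zero_of_weightedSq_eq_zero hR hy
  -- The auxiliary functions of the invariance principle are the momenta.
  refine (hP.isLyapunovFunction_hamiltonianPI hM hKI hR).isAsymptoticallyStableEquilibrium
    (hP.contDiff_closedLoop hM hKI) ?_
    (h := fun (i : JointIdx) y => y (Sum.inr i)) (fun i => contDiff_state_apply _) ?_ ?_
  · rw [hP.closedLoop_eq hM hKI, hP.gradient_hamiltonianPI_mkState hM hKI]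
    simp
  · exact fun y hy i => congrFun (hP.momentum_eq_zero_of_gradient hM (congrFun (hgp y hy))) i
  · intro y hy hd
    refine hP.eq_of_gradient_hamiltonianPI_eq_zero hM hKI ?_
    ext i
    rcases i with i | i
    · have h := hd i
      -- With `∇_p H_PI = 0` the momentum equation reads `p' = -∇_q H_PI`.
      rw [inner_gradient_state_apply, hP.closedLoop_apply_inr hM hKI, hgp y hy] at h
      simpa using h
    · exact congrFun (hgp y hy) i

end ClosedLoop

end RobotParams

theorem proposition1
    (P : RobotParams) (hP : P.Positive) (hM : ∀ θ : ℝ, (P.linkInertia θ).PosDef)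
    (qs : Fin 2 → ℝ) (KPm KI KPl : Matrix (Fin 2) (Fin 2) ℝ)
    (hKPm : KPm.PosDef) (hKI : KI.PosDef)
    (hgain : (P.Dm + KPm - (1 / 4 : ℝ) • (KPl * P.Dl⁻¹ * KPlᵀ)).PosDef) :
    -- (i) port-Hamiltonian representation of the closed loop, with positive definite damping
    ((P.RPI₂ KPm KPl).PosDef ∧
      IsPortHamiltonian (P.closedLoop KPm KI KPl qs) (P.hamiltonianPI KI qs)
        (Matrix.fromBlocks 0 1 (-1) (JPI₂ KPl))
        (Matrix.fromBlocks 0 0 0 (P.RPI₂ KPm KPl))) ∧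
    -- (ii) asymptotic stability, with the Lyapunov function `H_PI`
    (IsAsymptoticallyStableEquilibrium (P.closedLoop KPm KI KPl qs) (mkState qs qs 0 0) ∧
      IsLyapunovFunction (P.closedLoop KPm KI KPl qs) (mkState qs qs 0 0)
        (P.hamiltonianPI KI qs)) := by
  have hR := hP.posDef_RPI₂ hgain
  exact ⟨⟨hR, hP.isPortHamiltonian_closedLoop hM hKI hR⟩,
    hP.isAsymptoticallyStableEquilibrium_closedLoop hM hKI hR,
    hP.isLyapunovFunction_hamiltonianPI hM hKI hR⟩
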